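/- Let $B$ be a set. For $f\colon A^n\to B$, the $i$-th variable is \emph{essential} in $f$ (or $f$ \emph{depends} on it) if changing the $i$-th coordinate of some tuple changes the value of $f$; $\operatorname{ess} f$ denotes the number of essential variables of $f$. For $f\colon A^n\to B$ and $g\colon A^m\to B$, write $f\le g$ if there is a map $\sigma\colon\{1,\dots,m\}\to\{1,\dots,n\}$ with $f(a_1,\dots,a_n)=g(a_{\sigma(1)},\dots,a_{\sigma(m)})$ for all $(a_1,\dots,a_n)\in A^n$; write $f\equiv g$ ($f$ and $g$ are \emph{equivalent}) if $f\le g$ and $g\le f$, and $f<g$ if $f\le g$ and $g\not\le f$. If $f$ has at least two essential variables, its \emph{arity gap} is $$\operatorname{gap} f=\operatorname{ess} f-\max_{g<f}\operatorname{ess} g,$$ where $g$ ranges over functions $A^p\to B$ of all arities $p\ge 1$. Let $n\ge 2$ and let $f\colon\{0,1\}^n\to B$ depend on all of its variables. Then $\operatorname{gap} f=2$ if and only if $f$ satisfies one of the following conditions: (a) $n=2$ and $f$ is a nonconstant function satisfying $f(0,0)=f(1,1)$; (b) $f=g\circ h$, where $g\colon\{0,1\}\to B$ is injective and $h\colon\{0,1\}^n\to\{0,1\}$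 is equivalent to one of the following Boolean functions, with addition and multiplication modulo $2$ and $c\in\{0,1\}$: - $x_1+x_2+\dots+x_m+c$ with $2\le m\le n$, - $x_1x_2+x_1+c$, - $x_1x_2+x_1x_3+x_2x_3+c$, - $x_1x_2+x_1x_3+x_2x_3+x_1+x_2+c$. Otherwise $\operatorname{gap} f=1$. -/

import Mathlib

namespace ArityGap

/-- The `i`-th variable is essential in `f : A^n → B`: changing the `i`-th coordinate of some
tuple changes the value of `f`. -/
def IsEssential {A B : Type*} {n : ℕ} (f : (Fin n → A) → B) (i : Fin n) : Prop :=
  ∃ (a : Fin n → A) (b : A), f a ≠ f (Function.update a i b)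

/-- The essential arity `ess f`: the number of essential variables of `f`. -/
noncomputable def ess {A B : Type*} {n : ℕ} (f : (Fin n → A) → B) : ℕ :=
  Set.ncard {i : Fin n | IsEssential f i}

/-- `f ≤ g`: the `n`-ary function `f` is a simple minor of the `m`-ary function `g`, that is,
`f = g(x_{σ(1)}, …, x_{σ(m)})` for some map `σ : {1, …, m} → {1, …, n}`. -/
def IsSimpleMinor {A B : Type*} {n m : ℕ} (f : (Fin n → A) → B) (g : (Fin m → A) → B) : Prop :=
  ∃ σ : Fin m → Fin n, f = fun a => g (fun i => a (σ i))

/-- `f < g`: `f` is a simple minor of `g`, and `g` is not a simple minor of `f`. -/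
def IsStrictMinor {A B : Type*} {n m : ℕ} (f : (Fin n → A) → B) (g : (Fin m → A) → B) : Prop :=
  IsSimpleMinor f g ∧ ¬ IsSimpleMinor g f

/-- `f ≡ g`: each of `f` and `g` is a simple minor of the other. -/
def IsEquivalent {A B : Type*} {n m : ℕ} (f : (Fin n → A) → B) (g : (Fin m → A) → B) : Prop :=
  IsSimpleMinor f g ∧ IsSimpleMinor g f

/-- `ess^< f = max {ess g : g < f}`, where `g` ranges over the functions of any positive arity.
The set is bounded above by the arity of `f`, and nonempty when `f` has at least two essential
variables (it then contains the essential arity of the diagonal function), so that the supremum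
is a maximum. -/
noncomputable def essLower {A B : Type*} {n : ℕ} (f : (Fin n → A) → B) : ℕ :=
  sSup {r : ℕ | ∃ p : ℕ, 0 < p ∧ ∃ g : (Fin p → A) → B, IsStrictMinor g f ∧ ess g = r}

/-- The arity gap `gap f = ess f - ess^< f`. The subtraction is never truncated, because
`g < f` implies `ess g < ess f`. -/
noncomputable def gap {A B : Type*} {n : ℕ} (f : (Fin n → A) → B) : ℕ :=
  ess f - essLower f

/-- The Boolean function `h : {0,1}^n → {0,1}` is equivalent to one of the functions
* `x₁ + ⋯ + x_m + c` with `2 ≤ m ≤ n`,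
* `x₁x₂ + x₁ + c`,
* `x₁x₂ + x₁x₃ + x₂x₃ + c`,
* `x₁x₂ + x₁x₃ + x₂x₃ + x₁ + x₂ + c`,

where `c ∈ {0,1}` and the arithmetic is modulo 2. -/
def IsListed {n : ℕ} (h : (Fin n → ZMod 2) → ZMod 2) : Prop :=
  ∃ c : ZMod 2,
    (∃ m : ℕ, 2 ≤ m ∧ m ≤ n ∧
      IsEquivalent h (fun x : Fin m → ZMod 2 => (∑ i, x i) + c)) ∨
    IsEquivalent h (fun x : Fin 2 → ZMod 2 => x 0 * x 1 + x 0 + c) ∨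
    IsEquivalent h (fun x : Fin 3 → ZMod 2 => x 0 * x 1 + x 0 * x 2 + x 1 * x 2 + c) ∨
    IsEquivalent h
      (fun x : Fin 3 → ZMod 2 => x 0 * x 1 + x 0 * x 2 + x 1 * x 2 + x 0 + x 1 + c)

/-- The two alternatives of the classification for `f : {0,1}^n → B`: either `n = 2` and `f` is
nonconstant with `f(0,0) = f(1,1)`, or `f = g ∘ h` with `g : {0,1} → B` injective and `h` a listed
Boolean function. -/
def IsExceptional {B : Type*} {n : ℕ} (f : (Fin n → ZMod 2) → B) : Prop :=
  (n = 2 ∧ (∃ a b, f a ≠ f b) ∧ f (fun _ => 0) = f (fun _ => 1)) ∨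
  (∃ (g : ZMod 2 → B) (h : (Fin n → ZMod 2) → ZMod 2),
    Function.Injective g ∧ IsListed h ∧ f = g ∘ h)

end ArityGap

/-! Call `f` losing if identifying any two variables makes the merged variable or a third one
inessential (`LosesTwo`). A function that is not losing has gap 1 (`gap_eq_one_of_not_losesTwo`). It
remains to show that losing functions are exceptional (`LosesTwo.isExceptional`) and that
exceptional ones have gap 2 (`IsExceptional.gap_eq_two`). For the second claim, alternative (a) is
direct, and since the gap is invariant under equivalence, (b) needs only a check of the listed
normal forms.

For two variables, losing means `f(0,0) = f(1,1)`. For three, each identification has two possible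
outcomes, and the eight resulting systems of equations are solved in `ternary_classification`.

With four or more variables, a losing function is a function of the parity
(`LosesTwo.exists_eq_comp_sum`), by induction on their number. Fix a variable `i` to a constant that
keeps all others essential (`exists_strongly_essential`). If the restriction is losing, it is a
nonconstant function of the parity, hence sensitive to every flip. If not, one of its
identifications loses nothing, so in `f` that identification loses exactly `i`. Either way the only
obstruction is an identification of `a` and `b` that loses `c` but keeps all variables other than
`a, b, c`. `LosesTwo.false_of_invariant` excludes it by following the points sensitive to `c`. -/

namespace ArityGap

/-! ### Identifications that lose exactly one further variable -/

section Core

variable {ι B : Type*} [DecidableEq ι]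

/-- The `k`-th unit vector; adding it flips the `k`-th coordinate. -/
def unitVec (k : ι) : ι → ZMod 2 := Pi.single k 1

/-- Every identification of two variables in `S` makes `f` lose a further variable of `S`. -/
def LosesTwo (f : (ι → ZMod 2) → B) (S : Finset ι) : Prop :=
  ∀ i ∈ S, ∀ j ∈ S, i ≠ j →
    (∀ x, x i = x j → f (x + unitVec i + unitVec j) = f x) ∨
    ∃ k ∈ S, k ≠ i ∧ k ≠ j ∧ ∀ x, x i = x j → f (x + unitVec k) = f x

@[simp] lemma unitVec_self (k : ι) : unitVec k k = 1 := by simp [unitVec]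

lemma unitVec_of_ne {k l : ι} (h : l ≠ k) : unitVec k l = 0 := by simp [unitVec, h]

@[simp] lemma add_unitVec_self (x : ι → ZMod 2) (k : ι) : (x + unitVec k) k = x k + 1 := by
  simp

lemma add_unitVec_of_ne (x : ι → ZMod 2) {k l : ι} (h : l ≠ k) : (x + unitVec k) l = x l := by
  simp [unitVec_of_ne h]

@[simp] lemma add_unitVec_add_unitVec (x : ι → ZMod 2) (k : ι) :
    x + unitVec k + unitVec k = x := by
  funext l
  simp [add_assoc, CharTwo.add_self_eq_zero]

lemma zmod_two_add_one_eq {u v : ZMod 2} (h : u ≠ v) : u + 1 = v := by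
  revert u v; decide

lemma zmod_two_eq_or_eq {u v : ZMod 2} (h : u ≠ v) (w : ZMod 2) : w = u ∨ w = v := by
  revert u v w; decide

lemma zmod_two_eq_of_ne {u v w : ZMod 2} (h : u ≠ v) (h' : w ≠ v) : u = w := by
  revert u v w; decide

lemma zmod_two_eq_or_add_one_eq (u v : ZMod 2) : u = v ∨ u + 1 = v := by
  revert u v; decide

lemma zmod_two_add_one_ne (u : ZMod 2) : u + 1 ≠ u := by
  revert u; decide

/-- A flip of `k` may be performed at a point where `x i` has a prescribed value, when `f` is
indifferent to flips of `i`. -/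
lemma exists_adjust {f : (ι → ZMod 2) → B} {a b c : ι} (hac : a ≠ c) (hbc : b ≠ c)
    (hinv : ∀ x, x a = x b → f (x + unitVec c) = f x) (v : ι → ZMod 2)
    (hv : ∀ x : ι → ZMod 2, x a = x b → (x + v) a = (x + v) b)
    (hdep : ∃ x, x a = x b ∧ f (x + v) ≠ f x) (t : ι) (htc : t ≠ c) :
    ∃ x, x a = x b ∧ x c = x t ∧ f (x + v) ≠ f x := by
  obtain ⟨x, hx, hne⟩ := hdep
  by_cases h : x c = x t
  · exact ⟨x, hx, h, hne⟩
  · refine ⟨x + unitVec c, ?_, ?_, ?_⟩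
    · simpa [add_unitVec_of_ne, hac, hbc, unitVec_of_ne] using hx
    · rw [add_unitVec_self, add_unitVec_of_ne _ htc]
      exact zmod_two_add_one_eq h
    · rw [add_right_comm, hinv _ (hv x hx), hinv _ hx]
      exact hne

/-- If `f` is indifferent to `c` on `x a = x b`, but not at a point where `x a = x m`, then the
identification of `a` and `m` loses a variable other than `a, b, c, m`. -/
lemma LosesTwo.exists_invariant {f : (ι → ZMod 2) → B} {S : Finset ι} (hP : LosesTwo f S)
    {a b c m : ι} (ha : a ∈ S) (hm : m ∈ S) (hab : a ≠ b) (hac : a ≠ c) (hbc : b ≠ c)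
    (hma : m ≠ a) (hmb : m ≠ b) (hmc : m ≠ c)
    (hinv : ∀ x, x a = x b → f (x + unitVec c) = f x)
    {x : ι → ZMod 2} (hx : f (x + unitVec c) ≠ f x) (hxm : x a = x m) :
    ∃ k ∈ S, k ≠ a ∧ k ≠ b ∧ k ≠ c ∧ k ≠ m ∧ ∀ y, y a = y m → f (y + unitVec k) = f y := by
  -- At `x` the coordinates `a` and `b` differ. Flipping `b`, or `a` together with `m`, makes them
  -- equal, and there `c` has no effect. So neither of these flips can be free when `a` and `m` are
  -- identified.
  have hxab : x a ≠ x b := fun h => hx (hinv x h)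
  have hcm : (x + unitVec c) a = (x + unitVec c) m := by
    rw [add_unitVec_of_ne _ hac, add_unitVec_of_ne _ hmc, hxm]
  rcases hP a ha m hm hma.symm with h | ⟨k, hk, hka, hkm, h⟩
  · exfalso
    apply hx
    rw [← h _ hcm, ← h _ hxm, add_right_comm x, add_right_comm (x + unitVec a)]
    apply hinv
    rw [add_unitVec_of_ne _ hma.symm, add_unitVec_of_ne _ hmb.symm, add_unitVec_self,
      add_unitVec_of_ne _ hab.symm]
    exact zmod_two_add_one_eq hxab
  · refine ⟨k, hk, hka, ?_, ?_, hkm, h⟩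
    · rintro rfl
      apply hx
      rw [← h _ hcm, ← h _ hxm, add_right_comm x]
      apply hinv
      rw [add_unitVec_of_ne _ hab, add_unitVec_self]
      exact (zmod_two_add_one_eq hxab.symm).symm
    · rintro rfl
      exact hx (h _ hxm)

/-- The two-sided form of `LosesTwo.exists_invariant`. -/
lemma LosesTwo.exists_invariant' {f : (ι → ZMod 2) → B} {S : Finset ι} (hP : LosesTwo f S)
    {a b c m s : ι} (ha : a ∈ S) (hb : b ∈ S) (hm : m ∈ S) (hab : a ≠ b) (hac : a ≠ c)
    (hbc : b ≠ c) (hma : m ≠ a) (hmb : m ≠ b) (hmc : m ≠ c)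
    (hinv : ∀ x, x a = x b → f (x + unitVec c) = f x) (hs : s = a ∨ s = b)
    {x : ι → ZMod 2} (hx : f (x + unitVec c) ≠ f x) (hxm : x s = x m) :
    ∃ k ∈ S, k ≠ a ∧ k ≠ b ∧ k ≠ c ∧ k ≠ m ∧ ∀ y, y s = y m → f (y + unitVec k) = f y := by
  rcases hs with rfl | rfl
  · exact hP.exists_invariant ha hm hab hac hbc hma hmb hmc hinv hx hxm
  · obtain ⟨k, hk, h1, h2, h3⟩ := hP.exists_invariant hb hm hab.symm hbc hac hmb hma hmc
      (fun x hx => hinv x hx.symm) hx hxm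
    exact ⟨k, hk, h2, h1, h3⟩

/-- If `f` is indifferent to `c` on `x a = x b` and to `b` on `x c = x m` and on `x c = x m'`, then
`x m = x m'` at every point where `f` is sensitive to `c`. -/
lemma eq_of_sensitive {f : (ι → ZMod 2) → B} {a b c m m' : ι} (hab : a ≠ b)
    (hmc : m ≠ c) (hmc' : m' ≠ c)
    (hinv : ∀ x, x a = x b → f (x + unitVec c) = f x)
    (hm : ∀ x, x c = x m → f (x + unitVec b) = f x)
    (hm' : ∀ x, x c = x m' → f (x + unitVec b) = f x)
    {x : ι → ZMod 2} (hx : f (x + unitVec c) ≠ f x) : x m = x m' := by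
  have hxab : x a ≠ x b := fun h => hx (hinv x h)
  -- If `x c = x p ≠ x q`, flipping `b` is free both before and after flipping `c`. Once `b` is
  -- flipped, `a` and `b` agree and `c` has no effect. Thus `x c` equals both or neither of `x m`,
  -- `x m'`.
  have key : ∀ p q : ι, q ≠ c →
      (∀ x, x c = x p → f (x + unitVec b) = f x) →
      (∀ x, x c = x q → f (x + unitVec b) = f x) → x c = x p → x c ≠ x q → False := by
    intro p q hqc hp hq h1 h2
    apply hx
    rw [← hp x h1, ← hq (x + unitVec c), add_right_comm]
    · apply hinv
      rw [add_unitVec_of_ne _ hab, add_unitVec_self]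
      exact (zmod_two_add_one_eq hxab.symm).symm
    · rw [add_unitVec_self, add_unitVec_of_ne _ hqc]
      exact zmod_two_add_one_eq h2
  by_cases h1 : x c = x m <;> by_cases h2 : x c = x m'
  · exact h1.symm.trans h2
  · exact (key m m' hmc' hm hm' h1 h2).elim
  · exact (key m' m hmc hm' hm h2 h1).elim
  · exact zmod_two_eq_of_ne (Ne.symm h1) (Ne.symm h2)

/-- Sensitivity to `c` survives a flip to which `f` is indifferent on `x s = x m`. -/
lemma sensitive_add_unitVec {f : (ι → ZMod 2) → B} {c k m s : ι} (hsc : s ≠ c) (hmc : m ≠ c)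
    (h : ∀ y, y s = y m → f (y + unitVec k) = f y) {x : ι → ZMod 2} (hxm : x s = x m)
    (hx : f (x + unitVec c) ≠ f x) :
    f (x + unitVec k + unitVec c) ≠ f (x + unitVec k) := by
  rw [add_right_comm, h _ hxm, h]
  · exact hx
  · rw [add_unitVec_of_ne _ hsc, add_unitVec_of_ne _ hmc, hxm]

/-- Under the hypotheses of `eq_of_sensitive`, a flip of `k` destroys sensitivity to `c`. -/
lemma not_sensitive_add_unitVec {f : (ι → ZMod 2) → B} {a b c m k : ι} (hab : a ≠ b)
    (hmc : m ≠ c) (hkc : k ≠ c) (hkm : k ≠ m)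
    (hinv : ∀ x, x a = x b → f (x + unitVec c) = f x)
    (hm : ∀ x, x c = x m → f (x + unitVec b) = f x)
    (hk : ∀ x, x c = x k → f (x + unitVec b) = f x)
    {x : ι → ZMod 2} (hx : f (x + unitVec c) ≠ f x)
    (hx' : f (x + unitVec k + unitVec c) ≠ f (x + unitVec k)) : False := by
  have h1 := eq_of_sensitive hab hmc hkc hinv hm hk hx
  have h2 := eq_of_sensitive hab hmc hkc hinv hm hk hx'
  rw [add_unitVec_self, add_unitVec_of_ne _ hkm.symm, h1] at h2
  exact zmod_two_add_one_ne _ h2.symm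

/-- If `f` is indifferent to `c` on `x a = x b` but depends there on all variables in `S` other than
`a, b, c`, then it is indifferent to `a` or to `b` after identifying `c` with any of these. -/
lemma LosesTwo.invariant_or {f : (ι → ZMod 2) → B} {S : Finset ι} (hP : LosesTwo f S)
    {a b c m : ι} (hc : c ∈ S) (hm : m ∈ S) (hac : a ≠ c)
    (hbc : b ≠ c) (hma : m ≠ a) (hmb : m ≠ b) (hmc : m ≠ c)
    (hinv : ∀ x, x a = x b → f (x + unitVec c) = f x)
    (hall : ∀ m ∈ S, m ≠ a → m ≠ b → m ≠ c → ∃ x, x a = x b ∧ f (x + unitVec m) ≠ f x) :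
    (∀ x, x c = x m → f (x + unitVec b) = f x) ∨ (∀ x, x c = x m → f (x + unitVec a) = f x) := by
  -- Flipping `c` is free on `x a = x b`, so the dependences in `hall` persist under the extra
  -- condition `x c = x m`. Hence only `a` or `b` can be lost.
  have adj : ∀ k ∈ S, k ≠ a → k ≠ b → k ≠ c →
      ∃ x, x a = x b ∧ x c = x m ∧ f (x + unitVec k) ≠ f x := fun k hk hka hkb hkc =>
    exists_adjust hac hbc hinv (unitVec k)
      (fun x hx => by rw [add_unitVec_of_ne _ hka.symm, add_unitVec_of_ne _ hkb.symm, hx])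
      (hall k hk hka hkb hkc) m hmc
  rcases hP c hc m hm hmc.symm with h | ⟨k, hk, hkc, hkm, h⟩
  · exfalso
    obtain ⟨x, hx, hxc, hne⟩ := adj m hm hma hmb hmc
    apply hne
    rw [← h x hxc, add_right_comm, hinv]
    rw [add_unitVec_of_ne _ hma.symm, add_unitVec_of_ne _ hmb.symm, hx]
  · by_cases hka : k = a
    · subst hka; exact Or.inr h
    by_cases hkb : k = b
    · subst hkb; exact Or.inl h
    obtain ⟨x, -, hxc, hne⟩ := adj k hk hka hkb hkc
    exact (hne (h x hxc)).elim

/-- The case of `LosesTwo.false_of_invariant` where identifying `c` with any other variable makes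
`f` indifferent to the same variable `b`. -/
lemma LosesTwo.false_of_uniform {f : (ι → ZMod 2) → B} {S : Finset ι} (hP : LosesTwo f S)
    {a b c m : ι} (ha : a ∈ S) (hb : b ∈ S) (hm : m ∈ S) (hab : a ≠ b) (hac : a ≠ c)
    (hbc : b ≠ c) (hma : m ≠ a) (hmb : m ≠ b) (hmc : m ≠ c)
    (hinv : ∀ x, x a = x b → f (x + unitVec c) = f x)
    (huni : ∀ m ∈ S, m ≠ a → m ≠ b → m ≠ c → ∀ x, x c = x m → f (x + unitVec b) = f x)
    {x : ι → ZMod 2} (hx : f (x + unitVec c) ≠ f x) : False := by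
  have hxab : x a ≠ x b := fun h => hx (hinv x h)
  obtain ⟨s, hs, hxs⟩ : ∃ s, (s = a ∨ s = b) ∧ x s = x m := by
    rcases zmod_two_eq_or_eq hxab (x m) with h | h
    · exact ⟨a, Or.inl rfl, h.symm⟩
    · exact ⟨b, Or.inr rfl, h.symm⟩
  have hsc : s ≠ c := by rcases hs with rfl | rfl <;> assumption
  obtain ⟨k, hk, hka, hkb, hkc, hkm, hinvk⟩ :=
    hP.exists_invariant' ha hb hm hab hac hbc hma hmb hmc hinv hs hx hxs
  -- Sensitive points satisfy `x m = x k`, yet flipping `k` preserves sensitivity.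
  exact not_sensitive_add_unitVec hab hmc hkc hkm hinv (huni m hm hma hmb hmc)
    (huni k hk hka hkb hkc) hx (sensitive_add_unitVec hsc hmc hinvk hxs hx)

/-- Suppose that identifying `c` with `m` makes `f` indifferent to `b`, and with `m'` to `a`. Then
identifying `a` or `b` with `m`, where `f` stays sensitive to `c`, makes `f` indifferent to `m'`. -/
lemma LosesTwo.invariant_partner {f : (ι → ZMod 2) → B} {S : Finset ι} (hP : LosesTwo f S)
    {a b c m m' s : ι} (ha : a ∈ S) (hb : b ∈ S) (hc : c ∈ S) (hm : m ∈ S)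
    (hab : a ≠ b) (hac : a ≠ c)
    (hbc : b ≠ c) (hma : m ≠ a) (hmb : m ≠ b) (hmc : m ≠ c) (hmc' : m' ≠ c)
    (hinv : ∀ x, x a = x b → f (x + unitVec c) = f x)
    (hall : ∀ m ∈ S, m ≠ a → m ≠ b → m ≠ c → ∃ x, x a = x b ∧ f (x + unitVec m) ≠ f x)
    (hI : ∀ x, x c = x m → f (x + unitVec b) = f x)
    (hI' : ∀ x, x c = x m' → f (x + unitVec a) = f x) (hs : s = a ∨ s = b)
    {x : ι → ZMod 2} (hx : f (x + unitVec c) ≠ f x) (hxs : x s = x m) :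
    ∀ y, y s = y m → f (y + unitVec m') = f y := by
  have hsc : s ≠ c := by rcases hs with rfl | rfl <;> assumption
  obtain ⟨k, hk, hka, hkb, hkc, hkm, hinvk⟩ :=
    hP.exists_invariant' ha hb hm hab hac hbc hma hmb hmc hinv hs hx hxs
  have hx' := sensitive_add_unitVec hsc hmc hinvk hxs hx
  -- Identifying `c` with `k` loses `b`, as for `m`, or `a`, as for `m'`. Two distinct variables
  -- losing the same one must agree at sensitive points, which flipping `k` would break. Only `k =
  -- m'` survives.
  rcases hP.invariant_or hc hk hac hbc hka hkb hkc hinv hall with h | h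
  · exact (not_sensitive_add_unitVec hab hmc hkc hkm hinv hI h hx hx').elim
  · by_cases hkm' : k = m'
    · subst hkm'; exact hinvk
    · exact (not_sensitive_add_unitVec hab.symm hmc' hkc hkm' (fun x hx => hinv x hx.symm)
        hI' h hx hx').elim

/-- The case of `LosesTwo.false_of_invariant` where identifying `c` with `m` makes `f` indifferent
to `b`, and identifying `c` with `m'` makes it indifferent to `a`. -/
lemma LosesTwo.false_of_mixed {f : (ι → ZMod 2) → B} {S : Finset ι} (hP : LosesTwo f S)
    {a b c m m' : ι} (ha : a ∈ S) (hb : b ∈ S) (hc : c ∈ S) (hm : m ∈ S) (hm' : m' ∈ S)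
    (hab : a ≠ b) (hac : a ≠ c) (hbc : b ≠ c) (hma : m ≠ a) (hmb : m ≠ b) (hmc : m ≠ c)
    (hma' : m' ≠ a) (hmb' : m' ≠ b) (hmc' : m' ≠ c) (hmm' : m ≠ m')
    (hinv : ∀ x, x a = x b → f (x + unitVec c) = f x)
    (hall : ∀ m ∈ S, m ≠ a → m ≠ b → m ≠ c → ∃ x, x a = x b ∧ f (x + unitVec m) ≠ f x)
    (hI : ∀ x, x c = x m → f (x + unitVec b) = f x)
    (hI' : ∀ x, x c = x m' → f (x + unitVec a) = f x)
    (hdep : ∃ x, f (x + unitVec c) ≠ f x) : False := by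
  have part : ∀ s, s = a ∨ s = b → ∀ x, f (x + unitVec c) ≠ f x → x s = x m →
      ∀ y, y s = y m → f (y + unitVec m') = f y := fun s hs x hx hxs =>
    hP.invariant_partner ha hb hc hm hab hac hbc hma hmb hmc hmc' hinv hall hI hI' hs hx hxs
  have part' : ∀ s, s = a ∨ s = b → ∀ x, f (x + unitVec c) ≠ f x → x s = x m' →
      ∀ y, y s = y m' → f (y + unitVec m) = f y := fun s hs x hx hxs =>
    hP.invariant_partner hb ha hc hm' hab.symm hbc hac hmb' hma' hmc' hmc
      (fun x hx => hinv x hx.symm)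
      (fun k hk h1 h2 h3 => by
        obtain ⟨x, hx, hne⟩ := hall k hk h2 h1 h3
        exact ⟨x, hx.symm, hne⟩) hI' hI hs.symm hx hxs
  have hne : ∀ {x}, f (x + unitVec c) ≠ f x → x a ≠ x b := fun hx h => hx (hinv _ h)
  have pick : ∀ x : ι → ZMod 2, x a ≠ x b → ∀ t, ∃ s, (s = a ∨ s = b) ∧ x s = x t := by
    intro x hx t
    rcases zmod_two_eq_or_eq hx (x t) with h | h
    · exact ⟨a, Or.inl rfl, h.symm⟩
    · exact ⟨b, Or.inr rfl, h.symm⟩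
  have hsc : ∀ s, s = a ∨ s = b → s ≠ c := by rintro s (rfl | rfl) <;> assumption
  have hsm : ∀ s, s = a ∨ s = b → s ≠ m := by
    rintro s (rfl | rfl) <;> apply Ne.symm <;> assumption
  have hsm' : ∀ s, s = a ∨ s = b → s ≠ m' := by
    rintro s (rfl | rfl) <;> apply Ne.symm <;> assumption
  have sens : ∀ x, f (x + unitVec c) ≠ f x →
      f (x + unitVec m + unitVec c) ≠ f (x + unitVec m) := by
    intro x hx
    obtain ⟨s, hs, hxs⟩ := pick x (hne hx) m'
    exact sensitive_add_unitVec (hsc s hs) hmc' (part' s hs x hx hxs) hxs hx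
  have sens' : ∀ x, f (x + unitVec c) ≠ f x →
      f (x + unitVec m' + unitVec c) ≠ f (x + unitVec m') := by
    intro x hx
    obtain ⟨s, hs, hxs⟩ := pick x (hne hx) m
    exact sensitive_add_unitVec (hsc s hs) hmc (part s hs x hx hxs) hxs hx
  obtain ⟨x₀, hx₀⟩ := hdep
  -- Since flipping `m` preserves sensitivity, a sensitive point can be made to agree with `m` at
  -- either of `a`, `b`, so both identifications lose `m'`.
  have inv' : ∀ z : ι → ZMod 2, z a ≠ z b → f (z + unitVec m') = f z := by
    intro z hz
    obtain ⟨s, hs, hzs⟩ := pick z hz m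
    by_cases h : x₀ s = x₀ m
    · exact part s hs x₀ hx₀ h z hzs
    · refine part s hs _ (sens x₀ hx₀) ?_ z hzs
      rw [add_unitVec_self, add_unitVec_of_ne _ (hsm s hs)]
      exact (zmod_two_add_one_eq (Ne.symm h)).symm
  obtain ⟨y, hy, hym, hyc⟩ : ∃ y, f (y + unitVec c) ≠ f y ∧ y m ≠ y m' ∧ y c = y m := by
    obtain ⟨y, hy, hym⟩ : ∃ y, f (y + unitVec c) ≠ f y ∧ y m ≠ y m' := by
      by_cases h : x₀ m = x₀ m'
      · refine ⟨_, sens x₀ hx₀, ?_⟩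
        rw [add_unitVec_self, add_unitVec_of_ne _ hmm'.symm, h]
        exact zmod_two_add_one_ne _
      · exact ⟨x₀, hx₀, h⟩
    by_cases h : y c = y m
    · exact ⟨y, hy, hym, h⟩
    · refine ⟨y + unitVec c, ?_, ?_, ?_⟩
      · rw [add_unitVec_add_unitVec]; exact hy.symm
      · rwa [add_unitVec_of_ne _ hmc, add_unitVec_of_ne _ hmc']
      · rw [add_unitVec_self, add_unitVec_of_ne _ hmc]
        exact zmod_two_add_one_eq h
  have hyab := hne hy
  have hym1 : y c = y m' + 1 := by rw [hyc]; exact (zmod_two_add_one_eq hym.symm).symm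
  -- Two routes of free flips lead from `w` to points with different values: one to `y + unitVec c`,
  -- the other to `y`.
  set w := y + unitVec a + unitVec b with hw
  have hwb : w + unitVec b = y + unitVec a := by rw [hw, add_unitVec_add_unitVec]
  have hwa : w + unitVec a = y + unitVec b := by
    rw [hw, add_right_comm, add_unitVec_add_unitVec]
  -- Flip `b` (as `c = m`), then `c` (as `a = b`), then `a` (as now `c = m'`).
  have e1 : f w = f (y + unitVec c) := by
    rw [← hI w, hwb, ← hinv (y + unitVec a), add_right_comm, hI']
    · rw [add_unitVec_self, add_unitVec_of_ne _ hmc', hym1, add_assoc, CharTwo.add_self_eq_zero,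
        add_zero]
    · rw [add_unitVec_self, add_unitVec_of_ne _ hab.symm]
      exact zmod_two_add_one_eq hyab
    · simp only [hw]
      rw [add_unitVec_of_ne _ hbc.symm, add_unitVec_of_ne _ hmb, add_unitVec_of_ne _ hac.symm,
        add_unitVec_of_ne _ hma, hyc]
  -- Flip `m'` (as `a ≠ b`), then `a` (as now `c = m'`), then `b` (as `c = m`), then `m'` back.
  have e2 : f w = f y := by
    rw [← inv' w, ← hI', add_right_comm, hwa, add_right_comm, hI, inv' y hyab]
    · rw [add_unitVec_of_ne _ hmc'.symm, add_unitVec_of_ne _ hmm', hyc]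
    · rw [add_unitVec_of_ne _ hmc'.symm, add_unitVec_self]
      simp only [hw]
      rw [add_unitVec_of_ne _ hbc.symm, add_unitVec_of_ne _ hmb', add_unitVec_of_ne _ hac.symm,
        add_unitVec_of_ne _ hma', hym1]
    · simp only [hw]
      rw [add_unitVec_of_ne _ hab, add_unitVec_self, add_unitVec_self,
        add_unitVec_of_ne _ hab.symm]
      exact fun h => hyab (add_right_cancel h)
  exact hy (e1.symm.trans e2)

/-- A function that loses two variables under each identification cannot, for `a, b, c ∈ S`, be
indifferent to `c` on `x a = x b` and depend there on all variables of `S` other than `a, b, c`,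
provided that there are such variables. -/
theorem LosesTwo.false_of_invariant {f : (ι → ZMod 2) → B} {S : Finset ι} (hP : LosesTwo f S)
    {a b c m : ι} (ha : a ∈ S) (hb : b ∈ S) (hc : c ∈ S) (hm : m ∈ S)
    (hab : a ≠ b) (hac : a ≠ c) (hbc : b ≠ c) (hma : m ≠ a) (hmb : m ≠ b) (hmc : m ≠ c)
    (hinv : ∀ x, x a = x b → f (x + unitVec c) = f x)
    (hall : ∀ m ∈ S, m ≠ a → m ≠ b → m ≠ c → ∃ x, x a = x b ∧ f (x + unitVec m) ≠ f x)
    (hdep : ∃ x, f (x + unitVec c) ≠ f x) : False := by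
  obtain ⟨x, hx⟩ := id hdep
  have hor := fun k (hk : k ∈ S) hka hkb hkc =>
    hP.invariant_or (m := k) hc hk hac hbc hka hkb hkc hinv hall
  by_cases h0 : ∀ m ∈ S, m ≠ a → m ≠ b → m ≠ c → ∀ x, x c = x m → f (x + unitVec b) = f x
  · exact hP.false_of_uniform ha hb hm hab hac hbc hma hmb hmc hinv h0 hx
  by_cases h1 : ∀ m ∈ S, m ≠ b → m ≠ a → m ≠ c → ∀ x, x c = x m → f (x + unitVec a) = f x
  · exact hP.false_of_uniform hb ha hm hab.symm hbc hac hmb hma hmc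
      (fun x hx => hinv x hx.symm) h1 hx
  simp only [not_forall] at h0 h1
  obtain ⟨p, hp, hpa, hpb, hpc, y, hyp, hy⟩ := h0
  obtain ⟨q, hq, hqb, hqa, hqc, z, hzq, hz⟩ := h1
  have hIp := (hor p hp hpa hpb hpc).resolve_left fun h => hy (h y hyp)
  have hIq := (hor q hq hqa hqb hqc).resolve_right fun h => hz (h z hzq)
  refine hP.false_of_mixed ha hb hc hq hp hab hac hbc hqa hqb hqc hpa hpb hpc ?_ hinv hall
    hIq hIp hdep
  rintro rfl
  exact hy (hIq y hyp)

end Core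
-- Losing functions of at least four variables depend on the parity
section Parity

variable {ι B : Type*} [DecidableEq ι]

/-- A function that is invariant under flipping two equal coordinates in `S`, where `S` has at
least three elements, is invariant under flipping any two coordinates in `S`. -/
lemma invariant_pair {f : (ι → ZMod 2) → B} {S : Finset ι} (hS : 2 < S.card)
    (hself : ∀ i ∈ S, ∀ j ∈ S, i ≠ j → ∀ x, x i = x j → f (x + unitVec i + unitVec j) = f x)
    {i j : ι} (hi : i ∈ S) (hj : j ∈ S) (hij : i ≠ j) (x : ι → ZMod 2) :
    f (x + unitVec i + unitVec j) = f x := by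
  by_cases h : x i = x j
  · exact hself i hi j hj hij x h
  obtain ⟨k, hk, hki, hkj⟩ : ∃ k ∈ S, k ≠ i ∧ k ≠ j := by
    obtain ⟨k, hk, hk'⟩ := Finset.exists_mem_notMem_of_card_lt_card
      (s := {i, j}) (t := S) (lt_of_le_of_lt Finset.card_le_two hS)
    simp only [Finset.mem_insert, Finset.mem_singleton, not_or] at hk'
    exact ⟨k, hk, hk'.1, hk'.2⟩
  -- Flip `p` with `k`. Then `k` agrees with `q`, so `k` is flipped back together with `q`.
  have key : ∀ p q : ι, p ∈ S → q ∈ S → p ≠ q → k ≠ p → k ≠ q → x p ≠ x q → x k = x p →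
      f (x + unitVec p + unitVec q) = f x := by
    intro p q hp hq hpq hkp hkq hne hkx
    rw [← hself p hp k hk hkp.symm x hkx.symm, ← hself k hk q hq hkq (x + unitVec p + unitVec k),
      add_unitVec_add_unitVec]
    rw [add_unitVec_self, add_unitVec_of_ne _ hkp, add_unitVec_of_ne _ hkq.symm,
      add_unitVec_of_ne _ hpq.symm, hkx]
    exact zmod_two_add_one_eq hne
  rcases zmod_two_eq_or_eq h (x k) with h' | h'
  · exact key i j hi hj hij hki hkj h h'
  · rw [add_right_comm]
    exact key j i hj hi hij.symm hkj hki (Ne.symm h) h'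

/-- A function that is invariant under flipping two equal coordinates in `S`, and under flipping
any coordinate outside `S`, is a function of the parity of the coordinates in `S`. -/
lemma exists_eq_comp_sum [Fintype ι] {f : (ι → ZMod 2) → B} {S : Finset ι} (hS : 2 < S.card)
    (hself : ∀ i ∈ S, ∀ j ∈ S, i ≠ j → ∀ x, x i = x j → f (x + unitVec i + unitVec j) = f x)
    (hout : ∀ k ∉ S, ∀ x, f (x + unitVec k) = f x) :
    ∃ γ : ZMod 2 → B, ∀ x, f x = γ (∑ i ∈ S, x i) := by
  obtain ⟨o, ho⟩ : S.Nonempty := Finset.card_pos.1 (by omega)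
  have hpair : ∀ k ∈ S, ∀ (t : ZMod 2) (x : ι → ZMod 2),
      f (x + t • (unitVec k + unitVec o)) = f x := by
    intro k hk t x
    obtain rfl | rfl : t = 0 ∨ t = 1 := by revert t; decide
    · simp
    · rw [one_smul, ← add_assoc]
      by_cases hko : k = o
      · rw [hko, add_unitVec_add_unitVec]
      · exact invariant_pair hS hself hk ho hko x
  have hsum : ∀ T ⊆ S, ∀ x y : ι → ZMod 2,
      f (x + ∑ k ∈ T, y k • (unitVec k + unitVec o)) = f x := by
    intro T
    induction T using Finset.induction_on with
    | empty => intro _ x y; simp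
    | insert k T hkT ih =>
      intro hT x y
      rw [Finset.sum_insert hkT, ← add_assoc, ih (fun l hl => hT (Finset.mem_insert_of_mem hl)),
        hpair k (hT (Finset.mem_insert_self k T))]
  have hsum' : ∀ T : Finset ι, Disjoint T S → ∀ x y : ι → ZMod 2,
      f (x + ∑ k ∈ T, y k • unitVec k) = f x := by
    intro T
    induction T using Finset.induction_on with
    | empty => intro _ x y; simp
    | insert k T hkT ih =>
      intro hT x y
      rw [Finset.disjoint_insert_left] at hT
      rw [Finset.sum_insert hkT, ← add_assoc, ih hT.2]
      obtain h | h : y k = 0 ∨ y k = 1 := by generalize y k = t; revert t; decide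
      · simp [h]
      · rw [h, one_smul, hout k hT.1]
  refine ⟨fun t => f (t • unitVec o), fun x => ?_⟩
  -- These free flips clear the coordinates outside `S` and collect the parity of those in `S` at
  -- `o`.
  rw [← hsum S subset_rfl x x, ← hsum' (Finset.univ \ S) Finset.sdiff_disjoint _ x]
  congr 1
  have hx : x = ∑ k ∈ S, x k • unitVec k + ∑ k ∈ Finset.univ \ S, x k • (unitVec k : ι → ZMod 2) := by
    rw [add_comm, Finset.sum_sdiff (Finset.subset_univ S)]
    funext l
    simp [unitVec, Finset.sum_apply, Pi.single_apply]
  have hchar : ∀ z : ι → ZMod 2, z + z = 0 := fun z => by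
    funext l
    exact CharTwo.add_self_eq_zero _
  simp only [smul_add, Finset.sum_add_distrib, Finset.sum_smul]
  nth_rewrite 1 [hx]
  set u := ∑ k ∈ S, x k • (unitVec k : ι → ZMod 2)
  set v := ∑ k ∈ Finset.univ \ S, x k • (unitVec k : ι → ZMod 2)
  set w := ∑ k ∈ S, x k • (unitVec o : ι → ZMod 2)
  calc u + v + (u + w) + v = (u + u) + (v + v) + w := by abel
    _ = w := by rw [hchar, hchar, zero_add, zero_add]

/-- Some variable of `S` can be fixed so that the dependence on all other variables of `S` is
retained. -/
lemma exists_strongly_essential {f : (ι → ZMod 2) → B} {S : Finset ι} (hS : S.Nonempty)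
    (hdep : ∀ k ∈ S, ∃ x, f (x + unitVec k) ≠ f x) :
    ∃ i ∈ S, ∃ c, ∀ k ∈ S, k ≠ i → ∃ x, x i = c ∧ f (x + unitVec k) ≠ f x := by
  classical
  let E : ι × ZMod 2 → Finset ι := fun p =>
    S.filter fun k => k ≠ p.1 ∧ ∃ x, x p.1 = p.2 ∧ f (x + unitVec k) ≠ f x
  -- Choose the restriction retaining the most variables. If it lost `j`, then fixing `j` at a value
  -- where `f` is sensitive to `i` would retain the same variables and also `i`.
  obtain ⟨⟨i, c⟩, hic, hmax⟩ := Finset.exists_max_image (S ×ˢ (Finset.univ : Finset (ZMod 2)))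
    (fun p => (E p).card) (hS.product Finset.univ_nonempty)
  have hi : i ∈ S := (Finset.mem_product.1 hic).1
  refine ⟨i, hi, c, fun j hj hji => ?_⟩
  by_contra hnot
  push Not at hnot
  obtain ⟨x, hx⟩ := hdep j hj
  have hxc : x i ≠ c := fun h => hx (hnot x h)
  obtain ⟨y, hyi⟩ : ∃ y, f (y + unitVec i) ≠ f y := by
    by_contra hall
    push Not at hall
    apply hx
    rw [← hall x, ← hall (x + unitVec j), add_right_comm]
    apply hnot
    rw [add_unitVec_self]
    exact zmod_two_add_one_eq hxc
  obtain ⟨d, hd⟩ : ∃ d, ∃ y, y j = d ∧ f (y + unitVec i) ≠ f y := ⟨y j, y, rfl, hyi⟩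
  have hlt : (E (i, c)).card < (E (j, d)).card := by
    apply Finset.card_lt_card
    rw [Finset.ssubset_iff_of_subset]
    · refine ⟨i, ?_, ?_⟩
      · simp only [E, Finset.mem_filter]
        exact ⟨hi, hji.symm, hd⟩
      · simp [E]
    · intro k hk
      simp only [E, Finset.mem_filter] at hk ⊢
      obtain ⟨hkS, hki, z, hz, hkz⟩ := hk
      have hkj : k ≠ j := by
        rintro rfl
        exact hkz (hnot z hz)
      refine ⟨hkS, hkj, ?_⟩
      by_cases hzd : z j = d
      · exact ⟨z, hzd, hkz⟩
      · refine ⟨z + unitVec j, ?_, ?_⟩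
        · rw [add_unitVec_self]
          exact zmod_two_add_one_eq hzd
        · rw [add_right_comm, hnot z hz, hnot]
          · exact hkz
          · rw [add_unitVec_of_ne _ hki.symm, hz]
  exact absurd (hmax (j, d) (by simp [hj])) (not_le.2 hlt)

lemma update_add_unitVec (x : ι → ZMod 2) {i k : ι} (hki : k ≠ i) (c : ZMod 2) :
    Function.update (x + unitVec k) i c = Function.update x i c + unitVec k := by
  funext l
  by_cases h : l = i
  · subst h; simp [unitVec_of_ne hki.symm]
  · simp [h]

lemma update_add_unitVec_self (x : ι → ZMod 2) (i : ι) (c : ZMod 2) :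
    Function.update (x + unitVec i) i c = Function.update x i c := by
  funext l
  by_cases h : l = i
  · subst h; simp
  · simp [h, unitVec_of_ne h]

/-- If fixing the variable `i` to `c` turns `f` into a nonconstant function of the parity of the
remaining variables, then all identifications of variables lose both of them. -/
lemma LosesTwo.invariant_of_restriction {f : (ι → ZMod 2) → B} {S : Finset ι}
    (hP : LosesTwo f S) (hS : 3 < S.card) {i : ι} (hi : i ∈ S)
    (hdep : ∃ x, f (x + unitVec i) ≠ f x) {c : ZMod 2}
    (hc : ∀ k ∈ S, k ≠ i → ∀ x, x i = c → f (x + unitVec k) ≠ f x) :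
    ∀ p ∈ S, ∀ q ∈ S, p ≠ q → ∀ x, x p = x q → f (x + unitVec p + unitVec q) = f x := by
  intro p hp q hq hpq
  rcases hP p hp q hq hpq with h | ⟨k, hk, hkp, hkq, h⟩
  · exact h
  exfalso
  -- The point with all coordinates `c` satisfies every identification and is sensitive to all `k ≠
  -- i` in `S`, so only `i` can be lost.
  by_cases hki : k = i
  · subst hki
    obtain ⟨m, hm, hm'⟩ := Finset.exists_mem_notMem_of_card_lt_card
      (s := {p, q, k}) (t := S) (lt_of_le_of_lt Finset.card_le_three hS)
    simp only [Finset.mem_insert, Finset.mem_singleton, not_or] at hm'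
    exact hP.false_of_invariant hp hq hk hm hpq hkp.symm hkq.symm hm'.1 hm'.2.1 hm'.2.2 h
      (fun l hl _ _ hlk => ⟨fun _ => c, rfl, hc l hl hlk _ rfl⟩) hdep
  · exact hc k hk hki (fun _ => c) rfl (h _ rfl)

/-- A function that depends on exactly the variables in `S`, where `S` has at least four elements,
and that loses two variables under each identification, is a function of the parity of the
coordinates in `S`. -/
theorem LosesTwo.exists_eq_comp_sum [Fintype ι] {S : Finset ι} (hS : 3 < S.card)
    {f : (ι → ZMod 2) → B} (hP : LosesTwo f S)
    (hdep : ∀ k ∈ S, ∃ x, f (x + unitVec k) ≠ f x)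
    (hout : ∀ k ∉ S, ∀ x, f (x + unitVec k) = f x) :
    ∃ γ : ZMod 2 → B, ∀ x, f x = γ (∑ i ∈ S, x i) := by
  induction hn : S.card using Nat.strong_induction_on generalizing S f with
  | _ n ih =>
  subst hn
  suffices hself : ∀ p ∈ S, ∀ q ∈ S, p ≠ q → ∀ x, x p = x q →
      f (x + unitVec p + unitVec q) = f x from
    ArityGap.exists_eq_comp_sum (by omega) hself hout
  -- With four variables, losing a third variable would force the existence of a fifth. Three
  -- variables are no base case: the majority function is losing.
  by_cases h4 : S.card = 4
  · intro p hp q hq hpq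
    rcases hP p hp q hq hpq with h | ⟨k, hk, hkp, hkq, h⟩
    · exact h
    exfalso
    obtain ⟨m, hm, hm'⟩ := Finset.exists_mem_notMem_of_card_lt_card
      (s := {p, q, k}) (t := S) (lt_of_le_of_lt Finset.card_le_three hS)
    simp only [Finset.mem_insert, Finset.mem_singleton, not_or] at hm'
    obtain ⟨hmp, hmq, hmk⟩ := hm'
    obtain ⟨x, hx⟩ := hdep k hk
    have hxpq : x p ≠ x q := fun h' => hx (h x h')
    obtain ⟨s, hs, hxs⟩ : ∃ s, (s = p ∨ s = q) ∧ x s = x m := by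
      rcases zmod_two_eq_or_eq hxpq (x m) with h | h
      · exact ⟨p, Or.inl rfl, h.symm⟩
      · exact ⟨q, Or.inr rfl, h.symm⟩
    obtain ⟨l, hl, hlp, hlq, hlk, hlm, -⟩ := hP.exists_invariant' hp hq hm hpq hkp.symm hkq.symm
      hmp hmq hmk h hs hx hxs
    have hsub : ({l, m, k, p, q} : Finset ι) ⊆ S := by
      intro t ht
      simp only [Finset.mem_insert, Finset.mem_singleton] at ht
      rcases ht with rfl | rfl | rfl | rfl | rfl <;> assumption
    have hcard := Finset.card_le_card hsub
    rw [h4] at hcard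
    have : ({l, m, k, p, q} : Finset ι).card = 5 := by
      simp [*]
    omega
  obtain ⟨i, hi, c, hic⟩ := exists_strongly_essential (Finset.card_pos.1 (by omega)) hdep
  set g : (ι → ZMod 2) → B := fun x => f (Function.update x i c) with hg
  have hgf : ∀ x : ι → ZMod 2, x i = c → g x = f x := by
    rintro x rfl
    simp [hg]
  have hgk : ∀ k, k ≠ i → ∀ x, g (x + unitVec k) = f (Function.update x i c + unitVec k) := by
    intro k hk x
    simp only [hg, update_add_unitVec x hk]
  have hcard : (S.erase i).card = S.card - 1 := Finset.card_erase_of_mem hi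
  have hgdep : ∀ k ∈ S.erase i, ∃ x, g (x + unitVec k) ≠ g x := by
    intro k hk
    obtain ⟨hki, hkS⟩ := Finset.mem_erase.1 hk
    obtain ⟨x, hx, hne⟩ := hic k hkS hki
    refine ⟨x, ?_⟩
    rwa [hgf, hgf x hx]
    rwa [add_unitVec_of_ne _ hki.symm]
  by_cases hPg : LosesTwo g (S.erase i)
  · obtain ⟨γ, hγ⟩ := ih (S.erase i).card (by omega) (by omega) hPg hgdep (fun k hk x => by
      by_cases hki : k = i
      · subst hki
        simp only [hg, update_add_unitVec_self]
      · rw [hgk k hki, hout k fun h => hk (Finset.mem_erase.2 ⟨hki, h⟩)]) rfl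
    have hsum : ∀ k ∈ S.erase i, ∀ x : ι → ZMod 2,
        ∑ l ∈ S.erase i, (x + unitVec k) l = ∑ l ∈ S.erase i, x l + 1 := by
      intro k hk x
      simp only [Pi.add_apply, Finset.sum_add_distrib, unitVec, Pi.single_apply,
        Finset.sum_ite_eq', hk, if_true]
    have hγne : ∀ t, γ (t + 1) ≠ γ t := by
      obtain ⟨k, hk⟩ : (S.erase i).Nonempty := Finset.card_pos.1 (by omega)
      obtain ⟨x, hx⟩ := hgdep k hk
      rw [hγ, hγ x, hsum k hk] at hx
      intro t
      rcases zmod_two_eq_or_add_one_eq (∑ l ∈ S.erase i, x l) t with rfl | rfl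
      · exact hx
      · rw [add_assoc, CharTwo.add_self_eq_zero, add_zero]
        exact hx.symm
    refine hP.invariant_of_restriction hS hi (hdep i hi) (c := c) fun k hk hki x hx => ?_
    rw [← hgf x hx, ← hgf (x + unitVec k) (by rwa [add_unitVec_of_ne _ hki.symm]), hγ, hγ x,
      hsum k (Finset.mem_erase.2 ⟨hki, hk⟩)]
    exact hγne _
  · exfalso
    simp only [LosesTwo, not_forall, not_or, not_exists, not_and] at hPg
    -- This identification loses nothing in the restriction, so in `f` it can lose only `i`.
    obtain ⟨p, hp, q, hq, hpq, ⟨x, hx, hne⟩, hall⟩ := hPg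
    obtain ⟨hpi, hpS⟩ := Finset.mem_erase.1 hp
    obtain ⟨hqi, hqS⟩ := Finset.mem_erase.1 hq
    have hupd : ∀ x : ι → ZMod 2, x p = x q →
        Function.update x i c p = Function.update x i c q := fun x hx => by
      simpa [hpi, hqi] using hx
    rcases hP p hpS q hqS hpq with h | ⟨k, hk, hkp, hkq, h⟩
    · apply hne
      rw [hgk q hqi, update_add_unitVec x hpi]
      exact h _ (hupd x hx)
    by_cases hki : k = i
    · subst hki
      obtain ⟨m, hm, hm'⟩ := Finset.exists_mem_notMem_of_card_lt_card
        (s := {p, q, k}) (t := S) (lt_of_le_of_lt Finset.card_le_three hS)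
      simp only [Finset.mem_insert, Finset.mem_singleton, not_or] at hm'
      refine hP.false_of_invariant hpS hqS hk hm hpq hkp.symm hkq.symm hm'.1 hm'.2.1 hm'.2.2 h
        (fun l hl hlp hlq hlk => ?_) (hdep k hk)
      obtain ⟨y, hy, hyne⟩ := hall l (Finset.mem_erase.2 ⟨hlk, hl⟩) hlp hlq
      rw [hgk l hlk] at hyne
      exact ⟨_, hupd y hy, hyne⟩
    · obtain ⟨y, hy, hyne⟩ := hall k (Finset.mem_erase.2 ⟨hki, hk⟩) hkp hkq
      apply hyne
      rw [hgk k hki]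
      exact h _ (hupd y hy)

end Parity
-- Simple minors and bounds on essential arity
section SimpleMinors

variable {A B C : Type*} {n m p : ℕ}

lemma IsSimpleMinor.trans {f : (Fin n → A) → B} {g : (Fin m → A) → B} {h : (Fin p → A) → B}
    (hfg : IsSimpleMinor f g) (hgh : IsSimpleMinor g h) : IsSimpleMinor f h := by
  obtain ⟨σ, rfl⟩ := hfg
  obtain ⟨τ, rfl⟩ := hgh
  exact ⟨fun i => σ (τ i), rfl⟩

lemma IsSimpleMinor.comp_left {f : (Fin n → A) → B} {g : (Fin m → A) → B}
    (h : IsSimpleMinor f g) (φ : B → C) : IsSimpleMinor (φ ∘ f) (φ ∘ g) := by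
  obtain ⟨σ, rfl⟩ := h
  exact ⟨σ, rfl⟩

lemma IsEquivalent.comp_left {f : (Fin n → A) → B} {g : (Fin m → A) → B}
    (h : IsEquivalent f g) (φ : B → C) : IsEquivalent (φ ∘ f) (φ ∘ g) :=
  ⟨h.1.comp_left φ, h.2.comp_left φ⟩

lemma isEquivalent_perm (g : (Fin n → A) → B) (σ : Equiv.Perm (Fin n)) :
    IsEquivalent (fun a => g fun i => a (σ i)) g :=
  ⟨⟨σ, rfl⟩, ⟨σ.symm, by simp⟩⟩

lemma isEquivalent_refl (g : (Fin n → A) → B) : IsEquivalent g g :=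
  ⟨⟨id, rfl⟩, ⟨id, rfl⟩⟩

/-- A function takes the same value at tuples that agree on all essential variables. -/
lemma eq_of_eqOn_essential {f : (Fin n → A) → B} {x y : Fin n → A}
    (h : ∀ i, IsEssential f i → x i = y i) : f x = f y := by
  have key : ∀ T : Finset (Fin n), f (T.piecewise y x) = f x := by
    intro T
    induction T using Finset.induction_on with
    | empty => simp
    | insert k T hk ih =>
      rw [Finset.piecewise_insert, ← ih]
      by_cases hess : IsEssential f k
      · have : (T.piecewise y x) k = y k := by
          rw [Finset.piecewise_eq_of_notMem _ _ _ hk, h k hess]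
        rw [← this, Function.update_eq_self]
      · by_contra hne
        exact hess ⟨_, _, Ne.symm hne⟩
  rw [← key Finset.univ, Finset.piecewise_univ]

lemma ess_le_card_of_subset {f : (Fin n → A) → B} {T : Finset (Fin n)}
    (h : ∀ i, IsEssential f i → i ∈ T) : ess f ≤ T.card := by
  rw [ess, ← Set.ncard_coe_finset]
  exact Set.ncard_le_ncard (fun i hi => h i hi) T.finite_toSet

lemma card_le_ess {f : (Fin n → A) → B} {T : Finset (Fin n)}
    (h : ∀ i ∈ T, IsEssential f i) : T.card ≤ ess f := by
  rw [ess, ← Set.ncard_coe_finset]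
  exact Set.ncard_le_ncard (fun i hi => h i hi) (Set.toFinite _)

lemma ess_eq {f : (Fin n → A) → B} (h : ∀ i, IsEssential f i) : ess f = n := by
  apply le_antisymm
  · simpa using ess_le_card_of_subset (f := f) (T := Finset.univ) (by simp)
  · simpa using card_le_ess (f := f) (T := Finset.univ) (by simpa using h)

/-- If the essential variables of `f (a ∘ σ)` lie in the image of `T`, there are at most `|T|` of
them. -/
lemma ess_comp_le_card (f : (Fin n → A) → B) (σ : Fin n → Fin p) (T : Finset (Fin n))
    (h : ∀ v, (∀ t ∈ T, σ t ≠ v) → ¬ IsEssential (fun a : Fin p → A => f fun i => a (σ i)) v) :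
    ess (fun a : Fin p → A => f fun i => a (σ i)) ≤ T.card := by
  refine le_trans (ess_le_card_of_subset (T := T.image σ) fun v hv => ?_) Finset.card_image_le
  by_contra hT
  simp only [Finset.mem_image, not_exists, not_and] at hT
  exact h v hT hv

lemma IsSimpleMinor.ess_le {f : (Fin n → A) → B} {g : (Fin m → A) → B}
    (h : IsSimpleMinor f g) : ess f ≤ ess g := by
  classical
  obtain ⟨σ, rfl⟩ := h
  have hcard : ess g = (Finset.univ.filter (IsEssential g)).card := by
    rw [ess, ← Set.ncard_coe_finset]
    simp
  rw [hcard]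
  refine ess_comp_le_card g σ _ fun v hv => ?_
  rintro ⟨a, b, hab⟩
  apply hab
  apply eq_of_eqOn_essential
  intro i hi
  rw [Function.update_of_ne]
  exact hv i (by simpa using hi)

lemma IsEquivalent.ess_eq {f : (Fin n → A) → B} {g : (Fin m → A) → B}
    (h : IsEquivalent f g) : ess f = ess g :=
  le_antisymm h.1.ess_le h.2.ess_le

lemma IsEquivalent.essLower_eq {f : (Fin n → A) → B} {g : (Fin m → A) → B}
    (h : IsEquivalent f g) : essLower f = essLower g := by
  unfold essLower IsStrictMinor
  congr 1
  ext r
  constructor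
  · rintro ⟨p, hp, k, ⟨hk, hk'⟩, hr⟩
    exact ⟨p, hp, k, ⟨hk.trans h.1, fun H => hk' (h.1.trans H)⟩, hr⟩
  · rintro ⟨p, hp, k, ⟨hk, hk'⟩, hr⟩
    exact ⟨p, hp, k, ⟨hk.trans h.2, fun H => hk' (h.2.trans H)⟩, hr⟩

lemma IsEquivalent.gap_eq {f : (Fin n → A) → B} {g : (Fin m → A) → B}
    (h : IsEquivalent f g) : gap f = gap g := by
  rw [gap, gap, h.ess_eq, h.essLower_eq]

/-- A strict minor of a function of positive arity identifies two variables. -/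
lemma IsStrictMinor.exists_identified (hn : 0 < n) {g : (Fin p → A) → B} {f : (Fin n → A) → B}
    (h : IsStrictMinor g f) :
    ∃ σ : Fin n → Fin p, g = (fun a => f fun i => a (σ i)) ∧ ∃ i j, i ≠ j ∧ σ i = σ j := by
  obtain ⟨⟨σ, rfl⟩, hnot⟩ := h
  refine ⟨σ, rfl, ?_⟩
  by_contra hcon
  push Not at hcon
  have hinj : Function.Injective σ := fun i j hij => by
    by_contra hne
    exact hcon i j hne hij
  have : Nonempty (Fin n) := ⟨⟨0, hn⟩⟩
  -- An injective `σ` has a left inverse, which exhibits `f` as a minor of `g`.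
  refine hnot ⟨Function.invFun σ, ?_⟩
  simp only [Function.leftInverse_invFun hinj _]

lemma IsStrictMinor.ess_le (hn : 0 < n) {g : (Fin p → A) → B} {f : (Fin n → A) → B}
    (h : IsStrictMinor g f) : ess g ≤ n - 1 := by
  obtain ⟨σ, rfl, i, j, hij, hσ⟩ := h.exists_identified hn
  have hle := ess_comp_le_card f σ (Finset.univ.erase i) (by
    rintro v hv ⟨a, b, hab⟩
    apply hab
    refine congrArg f (funext fun l => ?_)
    rw [Function.update_of_ne]
    by_cases hl : l = i
    · rw [hl, hσ]
      exact hv j (by simp [hij.symm])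
    · exact hv l (by simp [hl]))
  simpa using hle

lemma essLower_le {f : (Fin n → A) → B} {r : ℕ}
    (h : ∀ (p : ℕ) (g : (Fin p → A) → B), IsStrictMinor g f → ess g ≤ r) : essLower f ≤ r := by
  rcases Set.eq_empty_or_nonempty
    {r : ℕ | ∃ p : ℕ, 0 < p ∧ ∃ g : (Fin p → A) → B, IsStrictMinor g f ∧ ess g = r} with he | hne
  -- The supremum of the empty set of naturals is `0`.
  · rw [essLower, he]
    simp
  · refine csSup_le hne ?_
    rintro _ ⟨p, _, g, hg, rfl⟩
    exact h p g hg

/-- The function `f` with the variable `i` replaced by the variable `j`. -/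
def identify (f : (Fin n → A) → B) (i j : Fin n) : (Fin n → A) → B :=
  fun a => f fun l => a (if l = i then j else l)

/-- The minor `identify f i j` is strict because `i` drops out: it has at most `n - 1` essential
variables, while `f` has `n`. -/
lemma card_le_essLower {f : (Fin n → A) → B} (hn : 0 < n) (hf : ∀ i, IsEssential f i)
    {i j : Fin n} (hij : i ≠ j) {T : Finset (Fin n)}
    (hT : ∀ k ∈ T, IsEssential (identify f i j) k) : T.card ≤ essLower f := by
  refine (card_le_ess hT).trans (le_csSup ⟨n - 1, ?_⟩ ⟨n, hn, identify f i j, ⟨⟨_, rfl⟩, ?_⟩, rfl⟩)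
  · rintro _ ⟨p, _, g, hg, rfl⟩
    exact hg.ess_le hn
  · intro hmin
    have h1 := hmin.ess_le
    have h2 : ess (identify f i j) ≤ (Finset.univ.erase i).card := by
      apply ess_le_card_of_subset
      intro k hk
      rw [Finset.mem_erase]
      refine ⟨?_, Finset.mem_univ _⟩
      rintro rfl
      obtain ⟨a, b, hab⟩ := hk
      apply hab
      unfold identify
      congr 1
      funext l
      rw [Function.update_of_ne]
      split_ifs with hl
      · exact hij.symm
      · exact hl
    rw [ess_eq hf] at h1
    simp at h2
    omega

end SimpleMinors

/-! ### Computing the gap of functions on `{0,1}` -/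

section Binary

variable {B : Type*} {n : ℕ}

lemma isEssential_iff {f : (Fin n → ZMod 2) → B} {k : Fin n} :
    IsEssential f k ↔ ∃ x, f (x + unitVec k) ≠ f x := by
  have hupd : ∀ x : Fin n → ZMod 2, Function.update x k (x k + 1) = x + unitVec k := by
    intro x
    funext l
    by_cases h : l = k
    · subst h; simp
    · simp [h, unitVec_of_ne h]
  constructor
  · rintro ⟨x, b, h⟩
    refine ⟨x, ?_⟩
    rcases zmod_two_eq_or_add_one_eq (x k) b with rfl | rfl
    · simp at h
    · rw [← hupd]
      exact h.symm
  · rintro ⟨x, h⟩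
    exact ⟨x, x k + 1, by rw [hupd]; exact h.symm⟩

lemma identify_eq {f : (Fin n → ZMod 2) → B} {i j : Fin n} {x : Fin n → ZMod 2}
    (h : x i = x j) : identify f i j x = f x := by
  unfold identify
  congr 1
  funext l
  split_ifs with hl
  · rw [hl, h]
  · rfl

lemma isEssential_identify {f : (Fin n → ZMod 2) → B} {i j k : Fin n} (hki : k ≠ i) (hkj : k ≠ j)
    (h : ∃ x, x i = x j ∧ f (x + unitVec k) ≠ f x) : IsEssential (identify f i j) k := by
  obtain ⟨x, hx, hne⟩ := h
  refine isEssential_iff.2 ⟨x, ?_⟩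
  rwa [identify_eq, identify_eq hx]
  rwa [add_unitVec_of_ne _ hki.symm, add_unitVec_of_ne _ hkj.symm]

lemma isEssential_identify_right {f : (Fin n → ZMod 2) → B} {i j : Fin n} (hij : i ≠ j)
    (h : ∃ x, x i = x j ∧ f (x + unitVec i + unitVec j) ≠ f x) :
    IsEssential (identify f i j) j := by
  obtain ⟨x, hx, hne⟩ := h
  refine isEssential_iff.2 ⟨x, ?_⟩
  rw [identify_eq hx]
  convert hne using 1
  rw [add_right_comm]
  unfold identify
  congr 1
  funext l
  split_ifs with hl
  · subst hl
    rw [add_unitVec_self, add_unitVec_self, add_unitVec_of_ne _ hij, hx]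
  · rw [add_unitVec_of_ne _ hl]

/-- The identification witnessing the failure retains `n - 1` variables, the most that a strict
minor can have. -/
lemma gap_eq_one_of_not_losesTwo (hn : 2 ≤ n) {f : (Fin n → ZMod 2) → B}
    (hf : ∀ i, IsEssential f i) (h : ¬ LosesTwo f Finset.univ) : gap f = 1 := by
  simp only [LosesTwo, not_forall, not_or, not_exists, not_and] at h
  obtain ⟨i, -, j, -, hij, ⟨x, hx, hne⟩, hall⟩ := h
  have h1 : (Finset.univ.erase i).card ≤ essLower f :=
    card_le_essLower (by omega) hf hij fun k hk => by
      have hki := Finset.ne_of_mem_erase hk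
      by_cases hkj : k = j
      · subst hkj
        exact isEssential_identify_right hij ⟨x, hx, hne⟩
      · obtain ⟨y, hy, hyne⟩ := hall k (Finset.mem_univ k) hki hkj
        exact isEssential_identify hki hkj ⟨y, hy, hyne⟩
  have h2 : essLower f ≤ n - 1 := essLower_le fun p g hg => hg.ess_le (by omega)
  simp at h1
  rw [gap, ess_eq hf]
  omega

lemma LosesTwo.essLower_le (hn : 0 < n) {f : (Fin n → ZMod 2) → B}
    (h : LosesTwo f Finset.univ) : essLower f ≤ n - 2 := by
  refine ArityGap.essLower_le fun p g hg => ?_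
  obtain ⟨σ, rfl, i, j, hij, hσ⟩ := hg.exists_identified hn
  have hcard : ∀ k, k ≠ i → ((Finset.univ.erase i).erase k).card = n - 2 := by
    intro k hk
    rw [Finset.card_erase_of_mem (by simp [hk]), Finset.card_erase_of_mem (by simp)]
    simp [Nat.sub_sub]
  rcases h i (Finset.mem_univ i) j (Finset.mem_univ j) hij with h | ⟨k, -, hki, hkj, h⟩
  · rw [← hcard j hij.symm]
    refine ess_comp_le_card f σ _ fun v hv => ?_
    rw [isEssential_iff]
    rintro ⟨x, hx⟩
    apply hx
    -- A flip of `v` pulls back to a flip of its whole fibre under `σ`, which here is either `{i,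
    -- j}` or empty.
    by_cases hvi : σ i = v
    · rw [← h (fun l => x (σ l)) (by simp only [hσ])]
      congr 1
      funext l
      by_cases hli : l = i
      · subst hli
        rw [add_unitVec_of_ne _ hij, add_unitVec_self, hvi, add_unitVec_self]
      by_cases hlj : l = j
      · subst hlj
        rw [add_unitVec_self, add_unitVec_of_ne _ hli, ← hσ, hvi, add_unitVec_self]
      · rw [add_unitVec_of_ne _ hlj, add_unitVec_of_ne _ hli,
          add_unitVec_of_ne _ (hv l (by simp [hli, hlj]))]
    · congr 1
      funext l
      rw [add_unitVec_of_ne]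
      by_cases hli : l = i
      · rwa [hli]
      by_cases hlj : l = j
      · rwa [hlj, ← hσ]
      · exact hv l (by simp [hli, hlj])
  · rw [← hcard k hki]
    refine ess_comp_le_card f σ _ fun v hv => ?_
    rw [isEssential_iff]
    rintro ⟨x, hx⟩
    apply hx
    have hσj : σ j ≠ v := hv j (by simp [hij.symm, hkj.symm])
    have hne : ∀ l, l ≠ k → σ l ≠ v := by
      intro l hlk
      by_cases hli : l = i
      · rwa [hli, hσ]
      · exact hv l (by simp [hli, hlk])
    by_cases hvk : σ k = v
    · rw [← h (fun l => x (σ l)) (by simp only [hσ])]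
      congr 1
      funext l
      by_cases hlk : l = k
      · subst hlk
        rw [hvk, add_unitVec_self, add_unitVec_self, hvk]
      · rw [add_unitVec_of_ne _ hlk, add_unitVec_of_ne _ (hne l hlk)]
    · congr 1
      funext l
      rw [add_unitVec_of_ne]
      by_cases hlk : l = k
      · rwa [hlk]
      · exact hne l hlk

/-- Losing gives only gap at least 2; the identification retaining `n - 2` variables gives equality.
-/
lemma LosesTwo.gap_eq_two (hn : 2 ≤ n) {f : (Fin n → ZMod 2) → B} (h : LosesTwo f Finset.univ)
    (hf : ∀ i, IsEssential f i) {i j : Fin n} (hij : i ≠ j) {T : Finset (Fin n)}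
    (hT : ∀ k ∈ T, IsEssential (identify f i j) k) (hcard : T.card = n - 2) : gap f = 2 := by
  have h1 := card_le_essLower (by omega) hf hij hT
  have h2 := h.essLower_le (by omega)
  rw [gap, ess_eq hf]
  omega

lemma LosesTwo.comp_left {C : Type*} {f : (Fin n → ZMod 2) → B} {S : Finset (Fin n)}
    (h : LosesTwo f S) (φ : B → C) : LosesTwo (φ ∘ f) S := by
  intro i hi j hj hij
  rcases h i hi j hj hij with h | ⟨k, hk, hki, hkj, h⟩
  · exact Or.inl fun x hx => congrArg φ (h x hx)
  · exact Or.inr ⟨k, hk, hki, hkj, fun x hx => congrArg φ (h x hx)⟩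

lemma IsEssential.comp_left {C : Type*} {f : (Fin n → ZMod 2) → B} {k : Fin n}
    (h : IsEssential f k) {φ : B → C} (hφ : Function.Injective φ) : IsEssential (φ ∘ f) k := by
  obtain ⟨a, b, hab⟩ := h
  exact ⟨a, b, fun H => hab (hφ H)⟩

lemma sum_add_unitVec (x : Fin n → ZMod 2) (k : Fin n) :
    ∑ l, (x + unitVec k) l = ∑ l, x l + 1 := by
  simp [unitVec, Finset.sum_add_distrib]

lemma gap_comp_sum {g : ZMod 2 → B} (hg : Function.Injective g) (hn : 2 ≤ n) (c : ZMod 2) :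
    gap (g ∘ fun x : Fin n → ZMod 2 => (∑ i, x i) + c) = 2 := by
  have hne : ∀ (x : Fin n → ZMod 2) (k : Fin n),
      ∑ i, (x + unitVec k) i + c ≠ ∑ i, x i + c := by
    intro x k h
    rw [sum_add_unitVec] at h
    exact zmod_two_add_one_ne _ (add_right_cancel h)
  have hij : (⟨0, by omega⟩ : Fin n) ≠ ⟨1, by omega⟩ := by simp
  refine LosesTwo.gap_eq_two hn (LosesTwo.comp_left ?_ g) (fun k => ?_) hij
    (T := (Finset.univ.erase ⟨0, by omega⟩).erase ⟨1, by omega⟩) (fun k hk => ?_) ?_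
  · intro i _ j _ _
    refine Or.inl fun x _ => ?_
    simp only [sum_add_unitVec]
    rw [add_assoc (∑ i, x i), CharTwo.add_self_eq_zero, add_zero]
  · exact (isEssential_iff.2 ⟨0, hne 0 k⟩).comp_left hg
  · simp only [Finset.mem_erase] at hk
    exact isEssential_identify hk.2.1 hk.1 ⟨0, rfl, fun h => hne 0 k (hg h)⟩
  · rw [Finset.card_erase_of_mem (by simp), Finset.card_erase_of_mem (by simp)]
    simp [Nat.sub_sub]

/-- Lets `decide` check the binary and ternary listed functions. -/
instance (f : (Fin n → ZMod 2) → ZMod 2) (S : Finset (Fin n)) : Decidable (LosesTwo f S) := by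
  unfold LosesTwo
  infer_instance

lemma gap_comp_of_ternary {g : ZMod 2 → B} (hg : Function.Injective g)
    {h : (Fin 3 → ZMod 2) → ZMod 2} (hP : LosesTwo h Finset.univ)
    (hess : ∀ k, ∃ x, h (x + unitVec k) ≠ h x)
    (hid : ∃ x, x 0 = x 1 ∧ h (x + unitVec 0 + unitVec 1) ≠ h x) : gap (g ∘ h) = 2 := by
  refine LosesTwo.gap_eq_two (by norm_num) (hP.comp_left g)
    (fun k => (isEssential_iff.2 (hess k)).comp_left hg) (i := 0) (j := 1) (by decide) (T := {1})
    (fun k hk => ?_) (by simp)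
  obtain rfl := Finset.mem_singleton.1 hk
  obtain ⟨x, hx, hne⟩ := hid
  exact isEssential_identify_right (by decide) ⟨x, hx, fun H => hne (hg H)⟩

lemma LosesTwo.gap_eq_two_of_binary {f : (Fin 2 → ZMod 2) → B} (hP : LosesTwo f Finset.univ)
    (hf : ∀ i, IsEssential f i) : gap f = 2 :=
  hP.gap_eq_two le_rfl hf (i := 0) (j := 1) (by decide) (T := ∅) (by simp) rfl

lemma losesTwo_of_binary {f : (Fin 2 → ZMod 2) → B} (h : f (fun _ => 0) = f (fun _ => 1)) :
    LosesTwo f Finset.univ := by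
  have hadd : ∀ i j : Fin 2, i ≠ j → unitVec i + unitVec j = fun _ => (1 : ZMod 2) := by decide
  have hx : ∀ i j : Fin 2, i ≠ j → ∀ x : Fin 2 → ZMod 2, x i = x j →
      x = (fun _ => 0) ∨ x = fun _ => 1 := by decide
  intro i _ j _ hij
  refine Or.inl fun x hxij => ?_
  rw [add_assoc, hadd i j hij]
  rcases hx i j hij x hxij with rfl | rfl
  · rw [h]; congr 1
  · rw [← h]; congr 1

theorem IsExceptional.gap_eq_two {f : (Fin n → ZMod 2) → B} (hf : ∀ i, IsEssential f i)
    (h : IsExceptional f) : gap f = 2 := by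
  rcases h with ⟨rfl, -, h⟩ | ⟨g, h, hg, ⟨c, hc⟩, rfl⟩
  · exact (losesTwo_of_binary h).gap_eq_two_of_binary hf
  rcases hc with ⟨m, hm, -, hc⟩ | hc | hc | hc <;> rw [(hc.comp_left g).gap_eq]
  · exact gap_comp_sum hg hm c
  · refine LosesTwo.gap_eq_two_of_binary (LosesTwo.comp_left ?_ g)
      fun k => (isEssential_iff.2 ?_).comp_left hg
    · clear hc; revert c; decide
    · clear hc; revert c k; decide
  · refine gap_comp_of_ternary hg ?_ ?_ ?_ <;> clear hc <;> revert c <;> decide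
  · refine gap_comp_of_ternary hg ?_ ?_ ?_ <;> clear hc <;> revert c <;> decide

end Binary
-- Losing functions are exceptional
/-- The ternary case of the classification, in terms of the conditions imposed by the three
identifications of variables. -/
lemma ternary_classification {B : Type*} {F : ZMod 2 → ZMod 2 → ZMod 2 → B}
    (h01 : (∀ a c, F (a + 1) (a + 1) c = F a a c) ∨ ∀ a c, F a a (c + 1) = F a a c)
    (h02 : (∀ a b, F (a + 1) b (a + 1) = F a b a) ∨ ∀ a b, F a (b + 1) a = F a b a)
    (h12 : (∀ b a, F a (b + 1) (b + 1) = F a b b) ∨ ∀ b a, F (a + 1) b b = F a b b)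
    (d1 : ∃ a b c, F a (b + 1) c ≠ F a b c)
    (d2 : ∃ a b c, F a b (c + 1) ≠ F a b c) :
    (∀ a b c, F a b c = F (a + b + c) (a + b + c) (a + b + c)) ∨
    (∀ a b c t, t = a * b + a * c + b * c → F a b c = F t t t) ∨
    (∀ a b c t, t = a * b + a * c + b * c + a + b → F a b c = F t t t) ∨
    (∀ a b c t, t = a * c + a * b + c * b + a + c → F a b c = F t t t) ∨
    (∀ a b c t, t = c * b + c * a + b * a + c + b → F a b c = F t t t) := by
  have h2 : (1 + 1 : ZMod 2) = 0 := rfl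
  have all : ∀ P : ZMod 2 → Prop, (∀ t, P t) ↔ P 0 ∧ P 1 := by
    intro P
    refine ⟨fun h => ⟨h 0, h 1⟩, fun h t => ?_⟩
    obtain rfl | rfl : t = 0 ∨ t = 1 := by revert t; decide
    exacts [h.1, h.2]
  have ex : ∀ P : ZMod 2 → Prop, (∃ t, P t) ↔ P 0 ∨ P 1 := by
    intro P
    refine ⟨fun ⟨t, h⟩ => ?_, fun h => h.elim (fun h => ⟨_, h⟩) fun h => ⟨_, h⟩⟩
    obtain rfl | rfl : t = 0 ∨ t = 1 := by clear h; revert t; decide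
    exacts [Or.inl h, Or.inr h]
  simp only [all, ex, zero_add, add_zero, h2, mul_zero, zero_mul, mul_one, forall_eq] at *
  -- If every identification loses the merged variable, the result is parity; if every one loses the
  -- third variable, majority. If exactly one loses the third, the result is one of the last three
  -- forms. If exactly two do, `F` depends on one variable only, against `d1` or `d2`.
  rcases h01 with h01 | h01 <;> rcases h02 with h02 | h02 <;> rcases h12 with h12 | h12 <;>
    grind (splits := 30)

section Classification

variable {B : Type*} {n : ℕ}

/-- A nonconstant function of the form `f x = f (t, …, t)`, where `t = h x` for a listed function
`h`, is exceptional. -/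
lemma isExceptional_of_eq {f : (Fin n → ZMod 2) → B} (hne : ∃ x y, f x ≠ f y)
    {h : (Fin n → ZMod 2) → ZMod 2} (hh : IsListed h) (g : ZMod 2 → B)
    (hfg : ∀ x, f x = g (h x)) : IsExceptional f := by
  refine Or.inr ⟨g, h, fun s t hst => ?_, hh, funext hfg⟩
  by_contra hst'
  obtain ⟨x, y, hxy⟩ := hne
  apply hxy
  have key : ∀ u, g u = g s := fun u => by
    rcases zmod_two_eq_or_eq hst' u with rfl | rfl
    exacts [rfl, hst.symm]
  rw [hfg, hfg, key, key (h y)]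

lemma isListed_sum (hn : 2 ≤ n) : IsListed fun x : Fin n → ZMod 2 => ∑ i, x i := by
  refine ⟨0, Or.inl ⟨n, hn, le_rfl, ?_⟩⟩
  simpa using isEquivalent_refl _

lemma vec_add_unitVec_zero (a b c : ZMod 2) : ![a, b, c] + unitVec 0 = ![a + 1, b, c] := by
  revert a b c; decide

lemma vec_add_unitVec_one (a b c : ZMod 2) : ![a, b, c] + unitVec 1 = ![a, b + 1, c] := by
  revert a b c; decide

lemma vec_add_unitVec_two (a b c : ZMod 2) : ![a, b, c] + unitVec 2 = ![a, b, c + 1] := by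
  revert a b c; decide

lemma LosesTwo.isExceptional_of_ternary {f : (Fin 3 → ZMod 2) → B}
    (hP : LosesTwo f Finset.univ) (hf : ∀ i, IsEssential f i) : IsExceptional f := by
  have hvec : ∀ x : Fin 3 → ZMod 2, x = ![x 0, x 1, x 2] := fun x => by
    funext i; fin_cases i <;> rfl
  have hthird : ∀ i j k : Fin 3, i ≠ j → k ≠ i → k ≠ j → ∀ l, l ≠ i → l ≠ j → l = k := by decide
  have hor : ∀ i j k : Fin 3, i ≠ j → k ≠ i → k ≠ j →
      (∀ x, x i = x j → f (x + unitVec i + unitVec j) = f x) ∨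
      ∀ x, x i = x j → f (x + unitVec k) = f x := by
    intro i j k hij hki hkj
    rcases hP i (Finset.mem_univ i) j (Finset.mem_univ j) hij with h | ⟨l, -, hli, hlj, h⟩
    · exact Or.inl h
    · rw [hthird i j k hij hki hkj l hli hlj] at h
      exact Or.inr h
  have hne : ∃ x y, f x ≠ f y := by
    obtain ⟨a, b, h⟩ := hf 0
    exact ⟨_, _, h⟩
  have hmain := ternary_classification (F := fun a b c => f ![a, b, c])
    ((hor 0 1 2 (by decide) (by decide) (by decide)).imp
      (fun h a c => by simpa only [vec_add_unitVec_zero, vec_add_unitVec_one] using h ![a, a, c] rfl)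
      (fun h a c => by simpa only [vec_add_unitVec_two] using h ![a, a, c] rfl))
    ((hor 0 2 1 (by decide) (by decide) (by decide)).imp
      (fun h a b => by simpa only [vec_add_unitVec_zero, vec_add_unitVec_two] using h ![a, b, a] rfl)
      (fun h a b => by simpa only [vec_add_unitVec_one] using h ![a, b, a] rfl))
    ((hor 1 2 0 (by decide) (by decide) (by decide)).imp
      (fun h b a => by simpa only [vec_add_unitVec_one, vec_add_unitVec_two] using h ![a, b, b] rfl)
      (fun h b a => by simpa only [vec_add_unitVec_zero] using h ![a, b, b] rfl))
    (by
      obtain ⟨x, hx⟩ := isEssential_iff.1 (hf 1)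
      rw [hvec x, vec_add_unitVec_one] at hx
      exact ⟨_, _, _, hx⟩)
    (by
      obtain ⟨x, hx⟩ := isEssential_iff.1 (hf 2)
      rw [hvec x, vec_add_unitVec_two] at hx
      exact ⟨_, _, _, hx⟩)
  have hfin : ∀ h : (Fin 3 → ZMod 2) → ZMod 2, IsListed h →
      (∀ x : Fin 3 → ZMod 2, f ![x 0, x 1, x 2] = f ![h x, h x, h x]) → IsExceptional f :=
    fun h hh hfh => isExceptional_of_eq hne hh (fun t => f ![t, t, t]) fun x => by
      rw [← hfh, ← hvec]
  rcases hmain with h | h | h | h | h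
  · refine hfin _ (isListed_sum (by norm_num)) fun x => ?_
    simpa only [Fin.sum_univ_three] using h (x 0) (x 1) (x 2)
  · refine hfin (fun x => x 0 * x 1 + x 0 * x 2 + x 1 * x 2) ⟨0, ?_⟩
      fun x => h (x 0) (x 1) (x 2) _ rfl
    refine Or.inr (Or.inr (Or.inl ?_))
    simpa only [add_zero] using isEquivalent_refl _
  all_goals
    refine hfin _ ⟨0, Or.inr (Or.inr (Or.inr ?_))⟩ fun x => h (x 0) (x 1) (x 2) _ rfl
    simp only [add_zero]
  · exact isEquivalent_refl _
  -- The order of terms in `ternary_classification` makes the swapped polynomial match literally.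
  · exact isEquivalent_perm (fun x : Fin 3 → ZMod 2 =>
      x 0 * x 1 + x 0 * x 2 + x 1 * x 2 + x 0 + x 1) (Equiv.swap 1 2)
  · exact isEquivalent_perm (fun x : Fin 3 → ZMod 2 =>
      x 0 * x 1 + x 0 * x 2 + x 1 * x 2 + x 0 + x 1) (Equiv.swap 0 2)

theorem LosesTwo.isExceptional (hn : 2 ≤ n) {f : (Fin n → ZMod 2) → B}
    (hP : LosesTwo f Finset.univ) (hf : ∀ i, IsEssential f i) : IsExceptional f := by
  have hne : ∃ x y, f x ≠ f y := by
    obtain ⟨a, b, h⟩ := hf ⟨0, by omega⟩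
    exact ⟨_, _, h⟩
  obtain rfl | rfl | hn4 : n = 2 ∨ n = 3 ∨ 3 < n := by omega
  · refine Or.inl ⟨rfl, hne, ?_⟩
    have hno : ∀ k : Fin 2, k ≠ 0 → k ≠ 1 → False := by decide
    have hadd : (fun _ => 0) + unitVec 0 + unitVec 1 = (fun _ => 1 : Fin 2 → ZMod 2) := by decide
    rcases hP 0 (Finset.mem_univ _) 1 (Finset.mem_univ _) (by decide) with h | ⟨k, -, hk, hk', -⟩
    · rw [← h _ rfl, hadd]
    · exact (hno k hk hk').elim
  · exact hP.isExceptional_of_ternary hf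
  · obtain ⟨γ, hγ⟩ := hP.exists_eq_comp_sum (by simpa using hn4)
      (fun k _ => isEssential_iff.1 (hf k)) (fun k hk => absurd (Finset.mem_univ k) hk)
    exact isExceptional_of_eq hne (isListed_sum hn) γ hγ

end Classification
end ArityGap

theorem mainTheorem3 {B : Type*} (n : ℕ) (hn : 2 ≤ n) (f : (Fin n → ZMod 2) → B)
    (hf : ∀ i : Fin n, ArityGap.IsEssential f i) :
    (ArityGap.gap f = 2 ↔ ArityGap.IsExceptional f) ∧
    (¬ ArityGap.IsExceptional f → ArityGap.gap f = 1) := by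
  have hone : ¬ ArityGap.IsExceptional f → ArityGap.gap f = 1 := fun h =>
    ArityGap.gap_eq_one_of_not_losesTwo hn hf fun hP => h (hP.isExceptional hn hf)
  refine ⟨⟨fun h => ?_, fun h => h.gap_eq_two hf⟩, hone⟩
  by_contra hex
  rw [hone hex] at h
  norm_num at h
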